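/- Let $d,N$ be natural numbers and let $\mathcal H=(\mathbb C^d)^{\otimes 2N}$ be the Hilbert space of a periodic spin chain with $2N$ sites, $\mathcal A=B(\mathcal H)$ its algebra of observables, and $\mathcal A_L\subset\mathcal A$ the algebra of operators acting on the first $N$ sites only, i.e. of the operators $y\otimes 1$ with $y\in B((\mathbb C^d)^{\otimes N})$. Let $U$ be the unitary operator on $\mathcal H$ with $$U(v_1\otimes v_2\otimes\dots\otimes v_{2N})=v_{2N-1}\otimes v_{2N}\otimes v_1\otimes\dots\otimes v_{2N-2},$$ which generates the $\mathbb Z/N$-rotations of the chain, and let $J$ be the anti-unitary operator on $\mathcal H$ with $$J(v_1\otimes v_2\otimes\dots\otimes v_{2N})=\bar v_{2N}\otimes\bar v_{2N-1}\otimes\dots\otimes\bar v_1,$$ where the bar is componentwise complex conjugation in $\mathbb C^d$. Let $\Omega\in\mathcal H$ be a unit vector and let $\rho=|\Omega\rangle\langle\Omega|$ be the density matrix of the pure state on $\mathcal A$ represented by $\Omega$. Suppose that this state is 1. invariant under $\mathbb Z/N$-rotations: $\operatorname{Tr}(\rho\,UaU^{-1})=\operatorname{Tr}(\rho\,a)$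 for all $a\in\mathcal A$; 2. reflection positive: $\operatorname{Tr}(\rho\,xJxJ)$ is real and $\ge 0$ for all $x\in\mathcal A_L$. Then the state has vanishing angular momentum: $U\Omega=\Omega$. -/

import Mathlib

open scoped ComplexOrder InnerProductSpace

noncomputable section

namespace SpinChain

/-- The Hilbert space `(ℂ^d)^{⊗ 2N}` of a spin chain with `2N` sites, in coordinates with respect to
the product basis: a vector is a complex function of the basis labels `σ : Fin (2 * N) → Fin d`,
and the inner product is the standard one. Site number `k = 1, …, 2N` is the index `k - 1`. -/
abbrev Hilb (d N : ℕ) : Type := EuclideanSpace ℂ (Fin (2 * N) → Fin d)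

/-- The Hilbert space `(ℂ^d)^{⊗ N}` of a half-chain with `N` sites. -/
abbrev HalfHilb (d N : ℕ) : Type := EuclideanSpace ℂ (Fin N → Fin d)

/-- The algebra of observables: all operators on the Hilbert space of the chain. -/
abbrev Obs (d N : ℕ) : Type := Module.End ℂ (Hilb d N)

/-- The product vector `v₁ ⊗ v₂ ⊗ ⋯ ⊗ v_{2N}`. -/
def productVec {d N : ℕ} (v : Fin (2 * N) → EuclideanSpace ℂ (Fin d)) : Hilb d N :=
  WithLp.toLp 2 fun σ => ∏ i, v i (σ i)

/-! ### The shift by two sites -/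

/-- The permutation `i ↦ i + 2` (cyclically) of the sites. -/
def shiftSites (N : ℕ) : Equiv.Perm (Fin (2 * N)) := finRotate (2 * N) * finRotate (2 * N)

theorem shiftSites_val (N : ℕ) (i : Fin (2 * N)) :
    (shiftSites N i : ℕ) = (i + 2) % (2 * N) := by
  obtain _ | N := N
  · exact i.elim0
  · change Fin (2 * N + 1 + 1) at i
    change ((finRotate (2 * N + 1 + 1) (finRotate (2 * N + 1 + 1) i) : Fin (2 * N + 1 + 1)) : ℕ)
      = (i + 2) % (2 * N + 1 + 1)
    rw [finRotate_apply, finRotate_apply, Fin.val_add, Fin.val_add]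
    simp [add_assoc]

/-- The unitary operator `U` with
`U (v₁ ⊗ ⋯ ⊗ v_{2N}) = v_{2N-1} ⊗ v_{2N} ⊗ v₁ ⊗ ⋯ ⊗ v_{2N-2}`, see `shiftTwo_productVec`. -/
def shiftTwo (d N : ℕ) : Hilb d N ≃ₗᵢ[ℂ] Hilb d N :=
  LinearIsometryEquiv.piLpCongrLeft 2 ℂ ℂ ((shiftSites N).arrowCongr (Equiv.refl (Fin d)))

theorem shiftTwo_apply {d N : ℕ} (ψ : Hilb d N) (σ : Fin (2 * N) → Fin d) :
    shiftTwo d N ψ σ = ψ fun i => σ (shiftSites N i) := by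
  rfl

theorem shiftTwo_productVec {d N : ℕ} (v : Fin (2 * N) → EuclideanSpace ℂ (Fin d)) :
    shiftTwo d N (productVec v) = productVec fun i => v ((shiftSites N).symm i) := by
  ext σ
  rw [shiftTwo_apply]
  exact Fintype.prod_equiv (shiftSites N) _ _ fun i => by simp

/-! ### The CRT reflection -/

/-- The anti-linear operator `J` with
`J (v₁ ⊗ v₂ ⊗ ⋯ ⊗ v_{2N}) = v̄_{2N} ⊗ ⋯ ⊗ v̄₂ ⊗ v̄₁`, see `crt_productVec`. -/
def crt (d N : ℕ) : Hilb d N →ₗ⋆[ℂ] Hilb d N where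
  toFun ψ := WithLp.toLp 2 fun σ => (starRingEnd ℂ) (ψ fun i => σ i.rev)
  map_add' ψ φ := by ext σ; simp
  map_smul' c ψ := by ext σ; simp

theorem crt_apply {d N : ℕ} (ψ : Hilb d N) (σ : Fin (2 * N) → Fin d) :
    crt d N ψ σ = (starRingEnd ℂ) (ψ fun i => σ i.rev) := rfl

theorem crt_productVec {d N : ℕ} (v : Fin (2 * N) → EuclideanSpace ℂ (Fin d)) :
    crt d N (productVec v) =
      productVec fun i => WithLp.toLp 2 fun k => (starRingEnd ℂ) (v i.rev k) := by
  ext σ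
  rw [crt_apply]
  simp only [productVec, map_prod]
  exact Fintype.prod_equiv Fin.revPerm _ _ fun i => by simp

theorem crt_crt {d N : ℕ} (ψ : Hilb d N) : crt d N (crt d N ψ) = ψ := by
  ext σ
  simp [crt_apply]

/-- `J` is anti-unitary. -/
theorem inner_crt_crt {d N : ℕ} (ψ φ : Hilb d N) :
    ⟪crt d N ψ, crt d N φ⟫_ℂ = ⟪φ, ψ⟫_ℂ := by
  simp only [PiLp.inner_apply, crt_apply]
  refine Fintype.sum_equiv (Fin.revPerm.arrowCongr (Equiv.refl (Fin d))) _ _ fun σ => ?_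
  simp [Equiv.arrowCongr, Function.comp_def, mul_comm]

/-- The (linear) operator `J x J`. -/
def crtConj {d N : ℕ} (x : Obs d N) : Obs d N := (crt d N).comp (x.comp (crt d N))

/-! ### Observables of the left half-chain -/

/-- The labels of the first `N` sites. -/
def leftHalf {d N : ℕ} (σ : Fin (2 * N) → Fin d) : Fin N → Fin d :=
  fun i => σ ⟨i, by have := i.isLt; omega⟩

/-- The labels of the last `N` sites. -/
def rightHalf {d N : ℕ} (σ : Fin (2 * N) → Fin d) : Fin N → Fin d :=
  fun i => σ ⟨N + i, by have := i.isLt; omega⟩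

/-- Replace the labels of the first `N` sites by `s`. -/
def replaceLeft {d N : ℕ} (s : Fin N → Fin d) (σ : Fin (2 * N) → Fin d) : Fin (2 * N) → Fin d :=
  fun i => if h : (i : ℕ) < N then s ⟨i, h⟩ else σ i

theorem leftHalf_replaceLeft {d N : ℕ} (s : Fin N → Fin d) (σ : Fin (2 * N) → Fin d) :
    leftHalf (replaceLeft s σ) = s := by
  funext i
  simp [leftHalf, replaceLeft]

theorem rightHalf_replaceLeft {d N : ℕ} (s : Fin N → Fin d) (σ : Fin (2 * N) → Fin d) :
    rightHalf (replaceLeft s σ) = rightHalf σ := by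
  funext i
  simp [rightHalf, replaceLeft]

theorem replaceLeft_replaceLeft {d N : ℕ} (s t : Fin N → Fin d) (σ : Fin (2 * N) → Fin d) :
    replaceLeft s (replaceLeft t σ) = replaceLeft s σ := by
  funext i
  by_cases h : (i : ℕ) < N <;> simp [replaceLeft, h]

theorem replaceLeft_leftHalf {d N : ℕ} (σ : Fin (2 * N) → Fin d) :
    replaceLeft (leftHalf σ) σ = σ := by
  funext i
  by_cases h : (i : ℕ) < N <;> simp [replaceLeft, leftHalf, h]

/-- The vector `u ⊗ w` of the chain, for vectors `u`, `w` of the left and right half-chains. -/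
def tensorHalves {d N : ℕ} (u w : HalfHilb d N) : Hilb d N :=
  WithLp.toLp 2 fun σ => u (leftHalf σ) * w (rightHalf σ)

/-- The operator `y ⊗ 1` for an operator `y` on the left half-chain: `y` acts on the labels of the
first `N` sites, the others being fixed; see `leftOp_tensorHalves`. -/
def extendLeft {d N : ℕ} (y : Module.End ℂ (HalfHilb d N)) : Obs d N where
  toFun ψ := WithLp.toLp 2 fun σ => y (WithLp.toLp 2 fun s => ψ (replaceLeft s σ)) (leftHalf σ)
  map_add' ψ φ := by
    ext σ
    exact congrArg (fun z : HalfHilb d N => z (leftHalf σ)) (map_add y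
      (WithLp.toLp 2 fun s => ψ (replaceLeft s σ)) (WithLp.toLp 2 fun s => φ (replaceLeft s σ)))
  map_smul' c ψ := by
    ext σ
    exact congrArg (fun z : HalfHilb d N => z (leftHalf σ)) (map_smul y c
      (WithLp.toLp 2 fun s => ψ (replaceLeft s σ)))

theorem extendLeft_apply {d N : ℕ} (y : Module.End ℂ (HalfHilb d N)) (ψ : Hilb d N)
    (σ : Fin (2 * N) → Fin d) :
    extendLeft y ψ σ = y (WithLp.toLp 2 fun s => ψ (replaceLeft s σ)) (leftHalf σ) := rfl

/-- The embedding `y ↦ y ⊗ 1` of the operators on the left half-chain into the observables. -/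
def leftOp (d N : ℕ) : Module.End ℂ (HalfHilb d N) →ₐ[ℂ] Obs d N :=
  AlgHom.ofLinearMap
    { toFun := extendLeft
      map_add' := fun _ _ => rfl
      map_smul' := fun _ _ => rfl }
    (by
      refine LinearMap.ext fun ψ => PiLp.ext fun σ => ?_
      change extendLeft 1 ψ σ = ψ σ
      simp [extendLeft_apply, replaceLeft_leftHalf])
    (fun y z => by
      refine LinearMap.ext fun ψ => PiLp.ext fun σ => ?_
      change extendLeft (y * z) ψ σ = extendLeft y (extendLeft z ψ) σ
      simp [extendLeft_apply, leftHalf_replaceLeft, replaceLeft_replaceLeft])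

theorem leftOp_tensorHalves {d N : ℕ} (y : Module.End ℂ (HalfHilb d N)) (u w : HalfHilb d N) :
    leftOp d N y (tensorHalves u w) = tensorHalves (y u) w := by
  ext σ
  change y (WithLp.toLp 2 fun s => tensorHalves u w (replaceLeft s σ)) (leftHalf σ) = _
  have h : (WithLp.toLp 2 fun s => tensorHalves u w (replaceLeft s σ) : HalfHilb d N)
      = w (rightHalf σ) • u := by
    ext s
    simp [tensorHalves, leftHalf_replaceLeft, rightHalf_replaceLeft, mul_comm]
  rw [h]
  simp [tensorHalves, mul_comm]

/-- The algebra of observables of the first `N` sites. -/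
def leftAlgebra (d N : ℕ) : Subalgebra ℂ (Obs d N) := (leftOp d N).range

/-! ### States -/

/-- The density matrix `|Ω⟩⟨Ω|` of the pure state represented by a unit vector `Ω`. -/
def pureState {d N : ℕ} (Ω : Hilb d N) : Obs d N :=
  (innerSL ℂ Ω).toLinearMap.smulRight Ω

theorem pureState_apply {d N : ℕ} (Ω ψ : Hilb d N) : pureState Ω ψ = ⟪Ω, ψ⟫_ℂ • Ω := rfl

theorem trace_pureState_mul {d N : ℕ} (Ω : Hilb d N) (a : Obs d N) :
    LinearMap.trace ℂ (Hilb d N) (pureState Ω * a) = ⟪Ω, a Ω⟫_ℂ := by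
  rw [LinearMap.trace_mul_comm]
  have : a * pureState Ω = (innerSL ℂ Ω).toLinearMap.smulRight (a Ω) := by
    ext1 ψ
    simp [pureState]
  rw [this, LinearMap.trace_smulRight]
  rfl

/-- The state `a ↦ Tr (ρ a)` is reflection positive: `Tr (ρ x J x J) ≥ 0` for every observable `x`
of the first `N` sites (the order on `ℂ`: the number is real and non-negative). -/
def IsReflectionPositive {d N : ℕ} (ρ : Obs d N) : Prop :=
  ∀ x ∈ leftAlgebra d N, 0 ≤ LinearMap.trace ℂ (Hilb d N) (ρ * (x * crtConj x))

/-- The state `a ↦ Tr (ρ a)` is invariant under the automorphism `a ↦ U a U⁻¹`, hence under the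
group `ℤ/N` of rotations of the periodic chain that it generates. -/
def IsRotationInvariant {d N : ℕ} (ρ : Obs d N) : Prop :=
  ∀ a : Obs d N,
    LinearMap.trace ℂ (Hilb d N) (ρ * (shiftTwo d N).toLinearEquiv.conj a) =
      LinearMap.trace ℂ (Hilb d N) (ρ * a)

end SpinChain

end

/-!
If a vector `φ` with `U φ = φ` is not orthogonal to `Ω`, then invariance of the state,
tested on the operator `|Ω⟩⟨φ|`, gives `⟪Ω, U Ω⟫ = ⟪Ω, Ω⟫` and hence `U Ω = Ω`. So it is
enough to find such a `φ`.

Cutting the chain in the middle and reading both halves towards the cut turns a vector `ψ`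
into a matrix `M`, and `J` into the conjugate transpose. Reflection positivity tested on rank one
operators says that the quadratic form of the matrix `M` of `Ω` takes values in a single ray
`c⁻¹ ℝ≥0`.

Take for `φ` the matrix product vector `σ ↦ Tr (A_{σ₁} ⋯ A_{σ_{2N}})` of Hermitian matrices
`A_a`. It is invariant under rotations because the trace is cyclic, and its matrix is
`Tr (A_s A_tᴴ)`, where `A_s` is the product of the `A_a` along the word `s`. Hence `c ⟪φ, Ω⟫`
is a sum of non-negative terms `c ⟪x, M x⟫`, one for each matrix entry `x = (s ↦ (A_s)_{ij})`.
As `c M` is positive semidefinite and non-zero, there is a word `s` of length `N` with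
`M_{ss} ≠ 0`. Let `A_a` be the adjacency matrix of the edges labelled `a` in the path
`0 - 1 - ⋯ - N` whose edges carry the labels `s`. A walk of length `N` from `0` to `N` spells
`s`, so the entry `(0, N)` contributes `c M_{ss} > 0`.
-/

namespace SpinChain

open Matrix

section InnerProductSpace

variable {𝕜 E : Type*} [RCLike 𝕜] [NormedAddCommGroup E] [InnerProductSpace 𝕜 E]

theorem eq_of_norm_eq_of_inner_eq_inner_self {x y : E} (hnorm : ‖x‖ = ‖y‖)
    (hinner : inner 𝕜 x y = inner 𝕜 x x) : x = y := by
  refine (eq_of_norm_le_re_inner_eq_norm_sq (𝕜 := 𝕜) hnorm.ge ?_).symm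
  rw [inner_re_symm, hinner, inner_self_eq_norm_sq]

theorem map_eq_self_of_inner_ne_zero (V : E ≃ₗᵢ[𝕜] E) {Ω φ : E}
    (hinv : ∀ a : Module.End 𝕜 E, inner 𝕜 Ω (V.toLinearEquiv.conj a Ω) = inner 𝕜 Ω (a Ω))
    (hφ : V φ = φ) (hφΩ : inner 𝕜 φ Ω ≠ 0) : V Ω = Ω := by
  have hsymm : inner 𝕜 φ (V.symm Ω) = inner 𝕜 φ Ω := by
    rw [← V.inner_map_map, hφ, V.apply_symm_apply]
  have htest := hinv ((innerSL 𝕜 φ).toLinearMap.smulRight Ω)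
  have hscaled : inner 𝕜 φ (V.symm Ω) * inner 𝕜 Ω (V Ω) = inner 𝕜 φ Ω * inner 𝕜 Ω Ω := by
    simpa [LinearEquiv.conj_apply_apply, inner_smul_right] using htest
  rw [hsymm] at hscaled
  exact (eq_of_norm_eq_of_inner_eq_inner_self (V.norm_map Ω).symm
    (mul_left_cancel₀ hφΩ hscaled)).symm

end InnerProductSpace

theorem IsRotationInvariant.shiftTwo_eq_self {d N : ℕ} {Ω φ : Hilb d N}
    (hrot : IsRotationInvariant (pureState Ω)) (hφ : shiftTwo d N φ = φ)
    (hφΩ : ⟪φ, Ω⟫_ℂ ≠ 0) : shiftTwo d N Ω = Ω :=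
  map_eq_self_of_inner_ne_zero (shiftTwo d N)
    (fun a => by simpa only [trace_pureState_mul] using hrot a) hφ hφΩ

/-! ### Quadratic forms of complex matrices -/

section QuadraticForm

variable {n : Type*} [Fintype n]

theorem trace_vecMulVec_star_mul {R : Type*} [CommSemiring R] [StarRing R] (u : n → R)
    (A : Matrix n n R) : (vecMulVec u (star u) * A).trace = star u ⬝ᵥ A *ᵥ u := by
  rw [vecMulVec_mul, trace_vecMulVec, dotProduct_comm, dotProduct_mulVec]

theorem vecMulVec_star_conjugate {R : Type*} [CommSemiring R] [StarRing R] (u v : n → R)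
    (A : Matrix n n R) : vecMulVec u (star v) * A * (vecMulVec u (star v))ᴴ =
      (star v ⬝ᵥ A *ᵥ v) • vecMulVec u (star u) := by
  rw [conjTranspose_vecMulVec, star_star, vecMulVec_mul, vecMulVec_mul_vecMulVec,
    ← dotProduct_mulVec, vecMulVec_smul]

theorem eq_zero_of_forall_dotProduct_mulVec_eq_zero {A : Matrix n n ℂ}
    (h : ∀ u, star u ⬝ᵥ A *ᵥ u = 0) : A = 0 := by
  classical
  apply toEuclideanLin.injective
  rw [map_zero, ← inner_map_self_eq_zero]
  intro x
  rw [inner_eq_zero_symm, EuclideanSpace.inner_eq_star_dotProduct, dotProduct_comm]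
  exact h _

theorem posSemidef_of_forall_dotProduct_mulVec_nonneg {A : Matrix n n ℂ}
    (h : ∀ u, 0 ≤ star u ⬝ᵥ A *ᵥ u) : A.PosSemidef := by
  classical
  rw [← isPositive_toEuclideanLin_iff, LinearMap.isPositive_iff_complex]
  intro x
  have hx : 0 ≤ ⟪toEuclideanLin A x, x⟫_ℂ := by
    rw [← inner_conj_symm, starRingEnd_apply, star_nonneg_iff,
      EuclideanSpace.inner_eq_star_dotProduct, dotProduct_comm]
    exact h _
  exact ⟨(Complex.eq_re_of_ofReal_le hx).symm, (Complex.le_def.mp hx).1⟩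

end QuadraticForm

/-! ### Vectors of the chain as matrices -/

section CoeffMatrix

variable {d N : ℕ}

/-- The configuration of the chain with labels `p.1` on the left half-chain and `p.2` on the right
one, where the right half-chain is read from the last site backwards, so that the reflection of the
chain exchanges the two components of `p`. -/
def foldEquiv (d N : ℕ) : (Fin N → Fin d) × (Fin N → Fin d) ≃ (Fin (2 * N) → Fin d) :=
  ((Equiv.refl _).prodCongr (Fin.revPerm.arrowCongr (Equiv.refl _))).trans
    ((Fin.appendEquiv N N).trans ((finCongr (two_mul N).symm).arrowCongr (Equiv.refl _)))

theorem foldEquiv_apply (s t : Fin N → Fin d) (i : Fin (2 * N)) :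
    foldEquiv d N (s, t) i = Fin.append s (t ∘ Fin.rev) (i.cast (two_mul N)) := rfl

theorem foldEquiv_rev (s t : Fin N → Fin d) :
    (fun i => foldEquiv d N (s, t) i.rev) = foldEquiv d N (t, s) := by
  funext i
  rw [foldEquiv_apply, foldEquiv_apply, Fin.cast_rev, Fin.append_rev]
  simp [Function.comp_def]

theorem leftHalf_foldEquiv (s t : Fin N → Fin d) : leftHalf (foldEquiv d N (s, t)) = s := by
  funext i
  exact Fin.append_left s (t ∘ Fin.rev) i

theorem replaceLeft_foldEquiv (r s t : Fin N → Fin d) :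
    replaceLeft r (foldEquiv d N (s, t)) = foldEquiv d N (r, t) := by
  funext i
  by_cases h : (i : ℕ) < N <;>
    simp [replaceLeft, foldEquiv_apply, Fin.append, Fin.addCases, Fin.castLT, h]

/-- The matrix of a vector of the chain, obtained by regarding the right half-chain, read backwards,
as a copy of the left one; see `foldEquiv`. -/
def coeffMatrix (ψ : Hilb d N) : Matrix (Fin N → Fin d) (Fin N → Fin d) ℂ :=
  of fun s t => ψ (foldEquiv d N (s, t))

theorem coeffMatrix_apply (ψ : Hilb d N) (s t : Fin N → Fin d) :
    coeffMatrix ψ s t = ψ (foldEquiv d N (s, t)) := rfl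

theorem coeffMatrix_eq_zero_iff {ψ : Hilb d N} : coeffMatrix ψ = 0 ↔ ψ = 0 := by
  refine ⟨fun h => PiLp.ext fun σ => ?_, fun h => by ext; simp [h, coeffMatrix_apply]⟩
  obtain ⟨⟨s, t⟩, rfl⟩ := (foldEquiv d N).surjective σ
  exact congrFun (congrFun h s) t

theorem inner_eq_trace_coeffMatrix (ψ φ : Hilb d N) :
    ⟪ψ, φ⟫_ℂ = ((coeffMatrix ψ)ᴴ * coeffMatrix φ).trace := by
  rw [PiLp.inner_apply, ← (foldEquiv d N).sum_comp, Fintype.sum_prod_type_right]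
  simp [trace, mul_apply, coeffMatrix_apply, mul_comm]

theorem coeffMatrix_crt (ψ : Hilb d N) : coeffMatrix (crt d N ψ) = (coeffMatrix ψ)ᴴ := by
  ext s t
  rw [coeffMatrix_apply, crt_apply, foldEquiv_rev, conjTranspose_apply, coeffMatrix_apply]
  rfl

theorem coeffMatrix_leftOp (Y : Matrix (Fin N → Fin d) (Fin N → Fin d) ℂ) (ψ : Hilb d N) :
    coeffMatrix (leftOp d N (toEuclideanLin Y) ψ) = Y * coeffMatrix ψ := by
  ext s t
  change extendLeft (toEuclideanLin Y) ψ (foldEquiv d N (s, t)) = _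
  simp only [extendLeft_apply, leftHalf_foldEquiv, replaceLeft_foldEquiv]
  rfl

theorem coeffMatrix_leftOp_mul_crtConj (Y : Matrix (Fin N → Fin d) (Fin N → Fin d) ℂ)
    (ψ : Hilb d N) :
    coeffMatrix ((leftOp d N (toEuclideanLin Y) * crtConj (leftOp d N (toEuclideanLin Y))) ψ) =
      Y * coeffMatrix ψ * Yᴴ := by
  change coeffMatrix (leftOp d N _ (crt d N (leftOp d N _ (crt d N ψ)))) = _
  rw [coeffMatrix_leftOp, coeffMatrix_crt, coeffMatrix_leftOp, coeffMatrix_crt,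
    conjTranspose_mul, conjTranspose_conjTranspose, Matrix.mul_assoc]

end CoeffMatrix

section ReflectionPositive

variable {d N : ℕ} {Ω : Hilb d N}

theorem IsReflectionPositive.trace_nonneg (hRP : IsReflectionPositive (pureState Ω))
    (Y : Matrix (Fin N → Fin d) (Fin N → Fin d) ℂ) :
    0 ≤ ((coeffMatrix Ω)ᴴ * (Y * coeffMatrix Ω * Yᴴ)).trace := by
  have h := hRP (leftOp d N (toEuclideanLin Y)) ⟨_, rfl⟩
  rwa [trace_pureState_mul, inner_eq_trace_coeffMatrix, coeffMatrix_leftOp_mul_crtConj] at h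

theorem IsReflectionPositive.star_quadraticForm_mul_nonneg
    (hRP : IsReflectionPositive (pureState Ω)) (u v : (Fin N → Fin d) → ℂ) :
    0 ≤ star (star u ⬝ᵥ coeffMatrix Ω *ᵥ u) * (star v ⬝ᵥ coeffMatrix Ω *ᵥ v) := by
  have hstar : star (star u ⬝ᵥ coeffMatrix Ω *ᵥ u) =
      ((coeffMatrix Ω)ᴴ * vecMulVec u (star u)).trace := by
    rw [← trace_vecMulVec_star_mul, ← trace_conjTranspose, conjTranspose_mul,
      conjTranspose_vecMulVec, star_star]
  have h := hRP.trace_nonneg (vecMulVec u (star v))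
  rwa [vecMulVec_star_conjugate, Matrix.mul_smul, trace_smul, smul_eq_mul, mul_comm,
    ← hstar] at h

theorem IsReflectionPositive.exists_smul_coeffMatrix_posSemidef
    (hRP : IsReflectionPositive (pureState Ω)) (hΩ : Ω ≠ 0) :
    ∃ c : ℂ, c ≠ 0 ∧ (c • coeffMatrix Ω).PosSemidef := by
  obtain ⟨u, hu⟩ : ∃ u, star u ⬝ᵥ coeffMatrix Ω *ᵥ u ≠ 0 := by
    by_contra! h
    exact hΩ (coeffMatrix_eq_zero_iff.mp (eq_zero_of_forall_dotProduct_mulVec_eq_zero h))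
  refine ⟨star (star u ⬝ᵥ coeffMatrix Ω *ᵥ u), star_ne_zero.mpr hu,
    posSemidef_of_forall_dotProduct_mulVec_nonneg fun v => ?_⟩
  rw [smul_mulVec, dotProduct_smul, smul_eq_mul]
  exact hRP.star_quadraticForm_mul_nonneg u v

end ReflectionPositive

/-! ### Matrix product vectors -/

section WordProd

variable {α κ R : Type*} [Fintype κ] [DecidableEq κ]

/-- The product `A (w 0) * ⋯ * A (w (n - 1))` of a family of matrices along a word `w`. -/
def wordProd [Semiring R] {n : ℕ} (A : α → Matrix κ κ R) (w : Fin n → α) : Matrix κ κ R :=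
  (List.ofFn fun i => A (w i)).prod

theorem wordProd_succ [Semiring R] {n : ℕ} (A : α → Matrix κ κ R) (w : Fin (n + 1) → α) :
    wordProd A w = A (w 0) * wordProd A fun i => w i.succ := by
  rw [wordProd, List.ofFn_succ, List.prod_cons, wordProd]

theorem wordProd_succ_last [Semiring R] {n : ℕ} (A : α → Matrix κ κ R) (w : Fin (n + 1) → α) :
    wordProd A w = (wordProd A fun i => w i.castSucc) * A (w (Fin.last n)) := by
  rw [wordProd, List.ofFn_succ', List.concat_eq_append, List.prod_append, List.prod_singleton,
    wordProd]

theorem wordProd_append [Semiring R] {m n : ℕ} (A : α → Matrix κ κ R) (v : Fin m → α)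
    (w : Fin n → α) : wordProd A (Fin.append v w) = wordProd A v * wordProd A w := by
  simp only [wordProd, List.ofFn_comp' _ A, List.ofFn_fin_append, List.map_append,
    List.prod_append]

theorem wordProd_comp_cast [Semiring R] {m n : ℕ} (h : m = n) (A : α → Matrix κ κ R)
    (w : Fin n → α) : (wordProd A fun i => w (i.cast h)) = wordProd A w := by
  subst h
  rfl

theorem trace_wordProd_comp_finRotate [CommSemiring R] {n : ℕ} (A : α → Matrix κ κ R)
    (w : Fin n → α) : (wordProd A fun i => w (finRotate n i)).trace = (wordProd A w).trace := by
  cases n with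
  | zero => rfl
  | succ n =>
    rw [wordProd_succ_last, finRotate_last, wordProd_succ A w, trace_mul_comm]
    simp only [finRotate_apply, Fin.coeSucc_eq_succ]

theorem conjTranspose_wordProd [Semiring R] [StarRing R] {n : ℕ} {A : α → Matrix κ κ R}
    (hA : ∀ a, (A a).IsHermitian) (w : Fin n → α) :
    (wordProd A w)ᴴ = wordProd A (w ∘ Fin.rev) := by
  induction n with
  | zero => exact conjTranspose_one
  | succ n ih =>
    rw [wordProd_succ, wordProd_succ_last A (w ∘ Fin.rev), conjTranspose_mul, ih, hA]
    simp [Function.comp_def, Fin.rev_castSucc]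

end WordProd

section MatrixProductVec

variable {d N : ℕ} {κ : Type*} [Fintype κ] [DecidableEq κ]

/-- The translation invariant matrix product vector with periodic boundary conditions, whose
coefficients are `Tr (A_{σ₁} ⋯ A_{σ_{2N}})`. -/
def matrixProductVec (A : Fin d → Matrix κ κ ℂ) : Hilb d N :=
  WithLp.toLp 2 fun σ => (wordProd A σ).trace

theorem shiftTwo_matrixProductVec (A : Fin d → Matrix κ κ ℂ) :
    shiftTwo d N (matrixProductVec A) = matrixProductVec A := by
  ext σ
  change (wordProd A fun i => σ (finRotate (2 * N) (finRotate (2 * N) i))).trace =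
    (wordProd A σ).trace
  rw [trace_wordProd_comp_finRotate A fun i => σ (finRotate (2 * N) i),
    trace_wordProd_comp_finRotate]

theorem coeffMatrix_matrixProductVec_apply {A : Fin d → Matrix κ κ ℂ}
    (hA : ∀ a, (A a).IsHermitian) (s t : Fin N → Fin d) :
    coeffMatrix (matrixProductVec A) s t = (wordProd A s * (wordProd A t)ᴴ).trace := by
  change (wordProd A (foldEquiv d N (s, t))).trace = _
  rw [conjTranspose_wordProd hA, ← wordProd_append, ← wordProd_comp_cast (two_mul N)]
  rfl

theorem coeffMatrix_matrixProductVec {A : Fin d → Matrix κ κ ℂ} (hA : ∀ a, (A a).IsHermitian) :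
    coeffMatrix (matrixProductVec (N := N) A) =
      ∑ i, ∑ j, vecMulVec (fun s => wordProd A s i j) (star fun s => wordProd A s i j) := by
  ext s t
  simp [coeffMatrix_matrixProductVec_apply hA, trace, mul_apply, Matrix.sum_apply,
    vecMulVec_apply]

theorem inner_matrixProductVec {A : Fin d → Matrix κ κ ℂ} (hA : ∀ a, (A a).IsHermitian)
    (ψ : Hilb d N) :
    ⟪matrixProductVec A, ψ⟫_ℂ = ∑ i, ∑ j,
      star (fun s => wordProd A s i j) ⬝ᵥ coeffMatrix ψ *ᵥ fun s => wordProd A s i j := by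
  rw [inner_eq_trace_coeffMatrix, coeffMatrix_matrixProductVec hA]
  simp only [conjTranspose_sum, conjTranspose_vecMulVec, star_star, Matrix.sum_mul, trace_sum,
    trace_vecMulVec_star_mul]

theorem dotProduct_wordProd_eq_zero_of_inner_eq_zero {A : Fin d → Matrix κ κ ℂ}
    (hA : ∀ a, (A a).IsHermitian) {ψ : Hilb d N} {c : ℂ} (hpos : (c • coeffMatrix ψ).PosSemidef)
    (hinner : ⟪matrixProductVec A, ψ⟫_ℂ = 0) (i j : κ) :
    star (fun s => wordProd A s i j) ⬝ᵥ (c • coeffMatrix ψ) *ᵥ (fun s => wordProd A s i j) = 0 := by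
  have hnonneg := hpos.dotProduct_mulVec_nonneg
  have hsum : ∑ i, ∑ j, star (fun s => wordProd A s i j) ⬝ᵥ
      (c • coeffMatrix ψ) *ᵥ (fun s => wordProd A s i j) = 0 := by
    simp only [smul_mulVec, dotProduct_smul, ← Finset.smul_sum]
    rw [← inner_matrixProductVec hA, hinner, smul_zero]
  rw [← Fintype.sum_prod_type', Fintype.sum_eq_zero_iff_of_nonneg fun p => hnonneg _] at hsum
  exact congrFun hsum (i, j)

end MatrixProductVec

/-! ### Labelled paths -/

section Hessenberg

variable {α R : Type*} {m n : ℕ}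

theorem wordProd_apply_eq_zero_of_lt [Semiring R] {A : α → Matrix (Fin m) (Fin m) R}
    (hA : ∀ a (i j : Fin m), (i : ℕ) + 1 < j → A a i j = 0)
    (w : Fin n → α) {i j : Fin m} (hij : (i : ℕ) + n < j) : wordProd A w i j = 0 := by
  induction n generalizing j with
  | zero => exact one_apply_ne (Fin.ne_of_lt hij)
  | succ n ih =>
    rw [wordProd_succ_last, mul_apply]
    refine Finset.sum_eq_zero fun l _ => ?_
    rcases lt_or_ge ((i : ℕ) + n) l with hl | hl
    · rw [ih _ hl, zero_mul]
    · rw [hA _ _ _ (by omega), mul_zero]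

theorem wordProd_apply_zero_eq_prod [CommSemiring R] {A : α → Matrix (Fin m) (Fin m) R}
    (hA : ∀ a (i j : Fin m), (i : ℕ) + 1 < j → A a i j = 0)
    (w : Fin n → α) (hn : n < m) :
    wordProd A w ⟨0, by omega⟩ ⟨n, hn⟩ =
      ∏ k : Fin n, A (w k) ⟨k, by omega⟩ ⟨k + 1, by omega⟩ := by
  induction n with
  | zero => exact one_apply_eq _
  | succ n ih =>
    rw [wordProd_succ_last, mul_apply, Fin.prod_univ_castSucc,
      Fintype.sum_eq_single ⟨n, by omega⟩, ih]
    · rfl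
    · intro l hl
      rcases lt_or_gt_of_ne hl with hlt | hgt
      · rw [hA _ _ _ (Nat.add_lt_add_right hlt 1), mul_zero]
      · rw [wordProd_apply_eq_zero_of_lt hA _ (by rwa [zero_add]), zero_mul]

end Hessenberg

section Path

variable {α : Type*} [DecidableEq α] {N : ℕ}

/-- The adjacency matrix of the edges labelled `a` in the path `0 - 1 - ⋯ - N` whose edge
`k - (k + 1)` is labelled `s k`. -/
def pathMatrix (s : Fin N → α) (a : α) : Matrix (Fin (N + 1)) (Fin (N + 1)) ℂ :=
  of fun i j => if ∃ k, s k = a ∧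
    (i = k.castSucc ∧ j = k.succ ∨ j = k.castSucc ∧ i = k.succ) then 1 else 0

theorem isHermitian_pathMatrix (s : Fin N → α) (a : α) : (pathMatrix s a).IsHermitian := by
  ext i j
  rw [conjTranspose_apply, pathMatrix, of_apply, of_apply, apply_ite star, star_one, star_zero]
  exact if_congr (exists_congr fun k => and_congr_right' or_comm) rfl rfl

theorem pathMatrix_apply_eq_zero (s : Fin N → α) (a : α) {i j : Fin (N + 1)}
    (hij : (i : ℕ) + 1 < j) : pathMatrix s a i j = 0 := by
  refine if_neg ?_
  rintro ⟨k, -, ⟨rfl, rfl⟩ | ⟨rfl, rfl⟩⟩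
  · simp at hij
  · simp only [Fin.val_succ, Fin.val_castSucc] at hij
    omega

theorem pathMatrix_castSucc_succ (s : Fin N → α) (a : α) (k : Fin N) :
    pathMatrix s a k.castSucc k.succ = if s k = a then 1 else 0 := by
  refine if_congr ⟨?_, fun h => ⟨k, h, Or.inl ⟨rfl, rfl⟩⟩⟩ rfl rfl
  rintro ⟨l, hl, ⟨hk, -⟩ | ⟨hk, hk'⟩⟩
  · rwa [Fin.castSucc_injective _ hk]
  · simp only [Fin.ext_iff, Fin.val_succ, Fin.val_castSucc] at hk hk'
    omega

theorem wordProd_pathMatrix_apply_zero_last (s w : Fin N → α) :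
    wordProd (pathMatrix s) w 0 (Fin.last N) = if w = s then 1 else 0 := by
  have hprod : wordProd (pathMatrix s) w 0 (Fin.last N) =
      ∏ k, pathMatrix s (w k) k.castSucc k.succ :=
    wordProd_apply_zero_eq_prod (fun a _ _ => pathMatrix_apply_eq_zero s a) w N.lt_succ_self
  simp [hprod, pathMatrix_castSucc_succ, Fintype.prod_boole, funext_iff, eq_comm]

end Path

theorem inner_matrixProductVec_pathMatrix_ne_zero {d N : ℕ} {ψ : Hilb d N} {c : ℂ} (hc : c ≠ 0)
    (hpos : (c • coeffMatrix ψ).PosSemidef) {s : Fin N → Fin d} (hs : coeffMatrix ψ s s ≠ 0) :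
    ⟪matrixProductVec (pathMatrix s), ψ⟫_ℂ ≠ 0 := by
  intro hinner
  have hentry : (fun w => wordProd (pathMatrix s) w 0 (Fin.last N)) = Pi.single s 1 := by
    ext w
    rw [wordProd_pathMatrix_apply_zero_last, Pi.single_apply]
  have hzero := dotProduct_wordProd_eq_zero_of_inner_eq_zero (isHermitian_pathMatrix s) hpos
    hinner 0 (Fin.last N)
  rw [hentry] at hzero
  exact mul_ne_zero hc hs (by simpa using hzero)

theorem IsReflectionPositive.exists_inner_matrixProductVec_pathMatrix_ne_zero {d N : ℕ}
    {Ω : Hilb d N} (hRP : IsReflectionPositive (pureState Ω)) (hΩ : Ω ≠ 0) :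
    ∃ s : Fin N → Fin d, ⟪matrixProductVec (pathMatrix s), Ω⟫_ℂ ≠ 0 := by
  obtain ⟨c, hc, hpos⟩ := hRP.exists_smul_coeffMatrix_posSemidef hΩ
  obtain ⟨s, hs⟩ : ∃ s, coeffMatrix Ω s s ≠ 0 := by
    by_contra! hdiag
    have htrace : (c • coeffMatrix Ω).trace = 0 := by simp [trace, hdiag]
    rw [hpos.trace_eq_zero_iff, smul_eq_zero_iff_right hc, coeffMatrix_eq_zero_iff] at htrace
    exact hΩ htrace
  exact ⟨s, inner_matrixProductVec_pathMatrix_ne_zero hc hpos hs⟩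

end SpinChain

theorem mainTheorem9 (d N : ℕ) (Ω : SpinChain.Hilb d N) (hΩ : ‖Ω‖ = 1)
    (hrot : SpinChain.IsRotationInvariant (SpinChain.pureState Ω))
    (hRP : SpinChain.IsReflectionPositive (SpinChain.pureState Ω)) :
    SpinChain.shiftTwo d N Ω = Ω := by
  have hΩ0 : Ω ≠ 0 := norm_ne_zero_iff.mp (hΩ ▸ one_ne_zero)
  obtain ⟨s, hs⟩ := hRP.exists_inner_matrixProductVec_pathMatrix_ne_zero hΩ0
  exact hrot.shiftTwo_eq_self (SpinChain.shiftTwo_matrixProductVec _) hs
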